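/- Let $L_{ord}=\{\prec\}$ be the first-order language (with equality) whose only non-logical symbol is a binary relation symbol $\prec$, interpreted as the strict order of ordinals. Let $On$ be the class of all ordinals, and identify each cardinal $\kappa$ with its initial ordinal, i.e. with the set of all ordinals smaller than it. Then for every uncountable cardinal $\kappa$, the structures $\langle\kappa,<\rangle$ and $\langle On,<\rangle$ are elementarily equivalent, $\langle\kappa,<\rangle\equiv_{L_{ord}}\langle On,<\rangle$: every sentence of $L_{ord}$ is true in $\langle\kappa,<\rangle$ if and only if it is true in $\langle On,<\rangle$. -/

import Mathlib

universe u

/-- The relation symbols of the first-order language of (strict) order: a single binary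
symbol `≺`. -/
inductive StrictOrderRel : ℕ → Type
  | prec : StrictOrderRel 2

/-- The first-order language of order `L_ord = {≺}`: no function or constant symbols, and one
binary relation symbol `≺` (besides the logical equality). -/
def strictOrderLanguage : FirstOrder.Language := ⟨fun _ => Empty, StrictOrderRel⟩

/-- Every type `A` carrying a relation `<` is the `L_ord`-structure `⟨A, <⟩`. -/
instance strictOrderStructure (A : Type*) [LT A] : strictOrderLanguage.Structure A where
  funMap := fun f => Empty.elim f
  RelMap
    | StrictOrderRel.prec => fun x => x 0 < x 1

open Ordinal FirstOrder

/-! This is an Ehrenfeucht–Fraïssé game. A position is a finite set of pairs, and the invariant is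
that corresponding gaps agree modulo `ω ^ n`, with `n` the number of moves left; each quantifier
costs one exponent (`exists_insert`, resting on `exists_add_eq`). The answer always lies less than
`ω ^ n` above a point already played, so the game stays inside any initial segment closed under
adding finite powers of `ω`. The class of all ordinals and every uncountable `κ` are such segments,
and the opening position `{(0, 0)}` has every rank. -/

/-- Equality of ordinals up to the quotient by `ω ^ a`: the remainders agree, and the quotients
are both zero or both nonzero. -/
def OmegaPowEquiv (a x y : Ordinal.{u}) : Prop :=
  x % ω ^ a = y % ω ^ a ∧ (x < ω ^ a ↔ y < ω ^ a)

namespace OmegaPowEquiv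

variable {a b x y z w : Ordinal.{u}}

theorem refl (a x : Ordinal.{u}) : OmegaPowEquiv a x x := ⟨rfl, Iff.rfl⟩

theorem symm (h : OmegaPowEquiv a x y) : OmegaPowEquiv a y x := ⟨h.1.symm, h.2.symm⟩

theorem omega_pow_ne_zero (a : Ordinal.{u}) : ω ^ a ≠ 0 := (opow_pos a omega0_pos).ne'

theorem eq_of_lt (h : OmegaPowEquiv a x y) (hx : x < ω ^ a) : x = y := by
  have := h.1
  rwa [mod_eq_of_lt hx, mod_eq_of_lt (h.2.1 hx)] at this

theorem eq_zero_iff (h : OmegaPowEquiv a x y) : x = 0 ↔ y = 0 := by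
  have key : ∀ {x y : Ordinal.{u}}, OmegaPowEquiv a x y → x = 0 → y = 0 := fun h hx => by
    rw [← h.eq_of_lt (hx ▸ opow_pos a omega0_pos), hx]
  exact ⟨key h, key h.symm⟩

theorem mono (hab : a ≤ b) (h : OmegaPowEquiv b x y) : OmegaPowEquiv a x y := by
  have hle : ω ^ a ≤ ω ^ b := opow_le_opow_right omega0_pos hab
  have key : ∀ {x y : Ordinal.{u}}, OmegaPowEquiv b x y → x < ω ^ a → y < ω ^ a := fun h hx =>
    h.eq_of_lt (hx.trans_le hle) ▸ hx
  refine ⟨?_, key h, key h.symm⟩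
  rw [← mod_mod_of_dvd x (opow_dvd_opow ω hab), h.1, mod_mod_of_dvd y (opow_dvd_opow ω hab)]

theorem add_mod_of_lt (x : Ordinal.{u}) (hy : y < ω ^ a) : (x + y) % ω ^ a = x % ω ^ a + y := by
  conv_lhs => rw [← div_add_mod x (ω ^ a), add_assoc, mul_add_mod_self]
  exact mod_eq_of_lt (isPrincipal_add_omega0_opow a (mod_lt x (omega_pow_ne_zero a)) hy)

/-- The remainder of `x` is below `ω ^ a`, hence absorbed by `y`. -/
theorem add_mod_of_le (x : Ordinal.{u}) (hy : ω ^ a ≤ y) : (x + y) % ω ^ a = y % ω ^ a := by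
  conv_lhs => rw [← div_add_mod x (ω ^ a), add_assoc, mul_add_mod_self,
    add_of_omega0_opow_le (mod_lt x (omega_pow_ne_zero a)) hy]

theorem add_lt_iff : x + y < ω ^ a ↔ x < ω ^ a ∧ y < ω ^ a :=
  ⟨fun h => ⟨le_self_add.trans_lt h, le_add_self.trans_lt h⟩,
    fun h => isPrincipal_add_omega0_opow a h.1 h.2⟩

theorem add (h : OmegaPowEquiv a x y) (h' : OmegaPowEquiv a z w) :
    OmegaPowEquiv a (x + z) (y + w) := by
  refine ⟨?_, by rw [add_lt_iff, add_lt_iff, h.2, h'.2]⟩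
  rcases lt_or_ge z (ω ^ a) with hz | hz
  · rw [add_mod_of_lt x hz, ← h'.eq_of_lt hz, add_mod_of_lt y hz, h.1]
  · rw [add_mod_of_le x hz, add_mod_of_le y (not_lt.1 (mt h'.2.2 hz.not_gt)), h'.1]

/-- Every ordinal is equivalent modulo `ω ^ a` to one below any larger power of `ω`. -/
theorem exists_lt (hab : a < b) (x : Ordinal.{u}) : ∃ y < ω ^ b, OmegaPowEquiv a x y := by
  have hlt : ω ^ a < ω ^ b := (opow_lt_opow_iff_right one_lt_omega0).2 hab
  rcases lt_or_ge x (ω ^ a) with hx | hx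
  · exact ⟨x, hx.trans hlt, refl a x⟩
  · have hm := mod_lt x (omega_pow_ne_zero a)
    -- A single copy of `ω ^ a` records that the quotient is nonzero.
    refine ⟨ω ^ a + x % ω ^ a, isPrincipal_add_omega0_opow b hlt (hm.trans hlt), ?_, ?_⟩
    · rw [add_mod_of_lt _ hm, mod_self, zero_add]
    · exact iff_of_false hx.not_gt (not_lt.2 le_self_add)

/-- A decomposition of an ordinal as a sum can be imitated in every equivalent ordinal, at the
price of a smaller power of `ω`. -/
theorem exists_add_eq (hab : a < b) (h : OmegaPowEquiv b (x + z) y) :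
    ∃ x' z', x' + z' = y ∧ OmegaPowEquiv a x x' ∧ OmegaPowEquiv a z z' := by
  rcases lt_or_ge z (ω ^ b) with hz | hz
  · have hm := mod_lt x (omega_pow_ne_zero b)
    -- A short tail is kept as it is; `x'` combines the quotient of `y` with the remainder of `x`.
    refine ⟨ω ^ b * (y / ω ^ b) + x % ω ^ b, z, ?_, mono hab.le ⟨?_, ?_⟩, refl a z⟩
    · rw [add_assoc, ← add_mod_of_lt x hz, h.1, div_add_mod]
    · rw [mul_add_mod_self, mod_mod]
    · have hx : x < ω ^ b ↔ y < ω ^ b := by rw [← h.2, add_lt_iff, and_iff_left hz]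
      rw [hx, add_lt_iff, and_iff_left hm]
      constructor
      · intro hy
        rw [div_eq_zero_of_lt hy, mul_zero]
        exact opow_pos b omega0_pos
      · intro hy
        rw [← div_add_mod y (ω ^ b)]
        exact add_lt_iff.2 ⟨hy, mod_lt y (omega_pow_ne_zero b)⟩
  · have hy : ω ^ b ≤ y := not_lt.1 (mt h.2.2 (hz.trans le_add_self).not_gt)
    -- A long tail absorbs any `x'` below `ω ^ b`, so `z' = y` serves.
    obtain ⟨x', hx', hxx'⟩ := exists_lt hab x
    refine ⟨x', y, add_of_omega0_opow_le hx' hy, hxx', mono hab.le ⟨?_, ?_⟩⟩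
    · rw [← h.1, add_mod_of_le x hz]
    · exact iff_of_false hz.not_gt hy.not_gt

end OmegaPowEquiv

/-- A set of pairs of ordinals is a partial correspondence of rank `a` if corresponding intervals
are equivalent modulo `ω ^ a`. -/
def IsOmegaPowCorrespondence (a : Ordinal.{u}) (P : Set (Ordinal.{u} × Ordinal.{u})) : Prop :=
  ∀ p ∈ P, ∀ q ∈ P, OmegaPowEquiv a (q.1 - p.1) (q.2 - p.2)

namespace IsOmegaPowCorrespondence

variable {a b : Ordinal.{u}} {P : Set (Ordinal.{u} × Ordinal.{u})} {p q : Ordinal.{u} × Ordinal.{u}}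

theorem mono (hab : a ≤ b) (h : IsOmegaPowCorrespondence b P) : IsOmegaPowCorrespondence a P :=
  fun p hp q hq => (h p hp q hq).mono hab

theorem preimage_swap (h : IsOmegaPowCorrespondence a P) :
    IsOmegaPowCorrespondence a (Prod.swap ⁻¹' P) :=
  fun _ hp _ hq => (h _ hp _ hq).symm

/-- Subtraction is truncated, so order is the vanishing of a gap, which the equivalence detects even
at rank 0. -/
theorem le_iff (h : IsOmegaPowCorrespondence a P) (hp : p ∈ P) (hq : q ∈ P) :
    p.1 ≤ q.1 ↔ p.2 ≤ q.2 := by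
  rw [← Ordinal.sub_eq_zero_iff_le, ← Ordinal.sub_eq_zero_iff_le, (h q hq p hp).eq_zero_iff]

theorem sub_add_sub {x y z : Ordinal.{u}} (hxy : x ≤ y) (hyz : y ≤ z) :
    (y - x) + (z - y) = z - x := by
  refine (sub_eq_of_add_eq ?_).symm
  rw [← add_assoc, Ordinal.add_sub_cancel_of_le hxy, Ordinal.add_sub_cancel_of_le hyz]

theorem insert {c d : Ordinal.{u}} (h : IsOmegaPowCorrespondence a P)
    (hc : ∀ p ∈ P, OmegaPowEquiv a (c - p.1) (d - p.2) ∧ OmegaPowEquiv a (p.1 - c) (p.2 - d)) :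
    IsOmegaPowCorrespondence a (Insert.insert (c, d) P) := by
  rintro p (rfl | hp) q (rfl | hq)
  · simpa using OmegaPowEquiv.refl a 0
  · exact (hc q hq).2
  · exact (hc p hp).1
  · exact h p hp q hq

/-- The extension step of the back-and-forth argument. -/
theorem exists_insert (hab : a < b) (h : IsOmegaPowCorrespondence b P) (hP : P.Finite)
    (h0 : (0, 0) ∈ P) (c : Ordinal.{u}) :
    ∃ d, (∃ p ∈ P, d < p.2 + ω ^ b) ∧ IsOmegaPowCorrespondence a (Insert.insert (c, d) P) := by
  obtain ⟨l, ⟨hl, hlc⟩, hlmax⟩ := Set.exists_max_image {p ∈ P | p.1 ≤ c} Prod.fst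
    (hP.subset (Set.sep_subset _ _)) ⟨(0, 0), h0, zero_le (a := c)⟩
  -- Gaps add up, so points to the left of `c` need only the gap from the nearest one, `l`.
  have below : ∀ s, OmegaPowEquiv a (c - l.1) s → ∀ p ∈ P, p.1 ≤ c →
      OmegaPowEquiv a (c - p.1) (l.2 + s - p.2) ∧
        OmegaPowEquiv a (p.1 - c) (p.2 - (l.2 + s)) := by
    intro s hs p hp hpc
    have hpl := hlmax p ⟨hp, hpc⟩
    have hpl' := (h.le_iff hp hl).1 hpl
    constructor
    · rw [← sub_add_sub hpl hlc, ← sub_add_sub hpl' le_self_add, add_sub_cancel]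
      exact ((h p hp l hl).mono hab.le).add hs
    · rw [Ordinal.sub_eq_zero_iff_le.2 hpc,
        Ordinal.sub_eq_zero_iff_le.2 (hpl'.trans le_self_add)]
      exact OmegaPowEquiv.refl a 0
  by_cases hne : {p ∈ P | c < p.1}.Nonempty
  · obtain ⟨r, ⟨hr, hcr⟩, hrmin⟩ := Set.exists_min_image {p ∈ P | c < p.1} Prod.fst
      (hP.subset (Set.sep_subset _ _)) hne
    -- `c` splits the gap between its neighbours `l` and `r`; the split is copied on the other side.
    have hlr := h l hl r hr
    rw [← sub_add_sub hlc hcr.le] at hlr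
    obtain ⟨s, t, hst, hs, ht⟩ := hlr.exists_add_eq hab
    have hr2 : l.2 + s + t = r.2 := by
      rw [add_assoc, hst, Ordinal.add_sub_cancel_of_le]
      exact (h.le_iff hl hr).1 (hlc.trans hcr.le)
    have hdr : l.2 + s ≤ r.2 := hr2 ▸ le_self_add
    refine ⟨l.2 + s, ⟨r, hr, hdr.trans_lt ?_⟩, (h.mono hab.le).insert fun p hp => ?_⟩
    · exact lt_add_of_pos_right _ (opow_pos b omega0_pos)
    rcases le_or_gt p.1 c with hpc | hcp
    · exact below s hs p hp hpc
    · have hrp := hrmin p ⟨hp, hcp⟩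
      have hrp' := (h.le_iff hr hp).1 hrp
      constructor
      · rw [Ordinal.sub_eq_zero_iff_le.2 hcp.le, Ordinal.sub_eq_zero_iff_le.2 (hdr.trans hrp')]
        exact OmegaPowEquiv.refl a 0
      · rw [← sub_add_sub hcr.le hrp, ← sub_add_sub hdr hrp', sub_eq_of_add_eq hr2]
        exact ht.add ((h r hr p hp).mono hab.le)
  -- With nothing to the right of `c`, a short representative of the gap keeps the answer within
  -- reach.
  · obtain ⟨s, hsb, hs⟩ := OmegaPowEquiv.exists_lt hab (c - l.1)
    refine ⟨l.2 + s, ⟨l, hl, (add_lt_add_iff_left _).2 hsb⟩, (h.mono hab.le).insert fun p hp => ?_⟩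
    exact below s hs p hp (not_lt.1 fun hcp => hne ⟨p, hp, hcp⟩)

end IsOmegaPowCorrespondence

/-- A linear order embedded as an initial segment of the ordinals that is closed under adding
finite powers of `ω`. -/
structure IsOmegaPowClosed {A : Type*} [LinearOrder A] (f : A → Ordinal.{u}) : Prop where
  strictMono : StrictMono f
  mem_range_of_lt : ∀ (x : A) (n : ℕ) (c : Ordinal.{u}), c < f x + ω ^ (n : Ordinal.{u}) →
    c ∈ Set.range f

/-- Over two initial segments closed under adding finite powers of `ω`, the truth value of a
formula is preserved by partial correspondences of sufficiently high finite rank. -/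
theorem exists_rank_realize_iff {α : Type*} {m : ℕ}
    (φ : strictOrderLanguage.BoundedFormula α m) :
    ∃ N : ℕ, ∀ {A B : Type*} [LinearOrder A] [LinearOrder B] {f : A → Ordinal.{u}}
      {g : B → Ordinal.{u}}, IsOmegaPowClosed f → IsOmegaPowClosed g →
      ∀ P : Set (Ordinal.{u} × Ordinal.{u}), P.Finite → (0, 0) ∈ P →
      P ⊆ Set.range f ×ˢ Set.range g → IsOmegaPowCorrespondence (N : Ordinal.{u}) P →
      ∀ (v : α → A) (w : α → B) (xs : Fin m → A) (ys : Fin m → B),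
      (∀ i, (f (Sum.elim v xs i), g (Sum.elim w ys i)) ∈ P) →
      (φ.Realize v xs ↔ φ.Realize w ys) := by
  have realize_mem : ∀ {m : ℕ} {A B : Type _} [LinearOrder A] [LinearOrder B]
      {f : A → Ordinal.{u}} {g : B → Ordinal.{u}} {P : Set (Ordinal.{u} × Ordinal.{u})}
      {v : α → A} {w : α → B} {xs : Fin m → A} {ys : Fin m → B},
      (∀ i, (f (Sum.elim v xs i), g (Sum.elim w ys i)) ∈ P) →
      ∀ t : strictOrderLanguage.Term (α ⊕ Fin m),
      (f (t.realize (Sum.elim v xs)), g (t.realize (Sum.elim w ys))) ∈ P := by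
    intro m A B _ _ f g P v w xs ys h t
    cases t with
    | var i => exact h i
    | func F _ => exact F.elim
  induction φ with
  | falsum => exact ⟨0, fun _ _ _ _ _ _ _ _ _ _ _ _ => Iff.rfl⟩
  | equal t₁ t₂ =>
    refine ⟨0, fun hf hg P _ _ _ hP v w xs ys h => ?_⟩
    have h₁ := realize_mem h t₁
    have h₂ := realize_mem h t₂
    have h₁₂ := hP.le_iff h₁ h₂
    have h₂₁ := hP.le_iff h₂ h₁
    simp only [hf.strictMono.le_iff_le, hg.strictMono.le_iff_le] at h₁₂ h₂₁
    change t₁.realize _ = t₂.realize _ ↔ t₁.realize _ = t₂.realize _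
    rw [le_antisymm_iff, le_antisymm_iff, h₁₂, h₂₁]
  | rel R ts =>
    cases R
    refine ⟨0, fun hf hg P _ _ _ hP v w xs ys h => ?_⟩
    have h₁₂ := hP.le_iff (realize_mem h (ts 1)) (realize_mem h (ts 0))
    simp only [hf.strictMono.le_iff_le, hg.strictMono.le_iff_le] at h₁₂
    change (ts 0).realize _ < (ts 1).realize _ ↔ (ts 0).realize _ < (ts 1).realize _
    rw [← not_le, ← not_le, h₁₂]
  | imp φ ψ ihφ ihψ =>
    obtain ⟨M, hM⟩ := ihφ
    obtain ⟨N, hN⟩ := ihψ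
    refine ⟨max M N, fun hf hg P hfin h0 hsub hP v w xs ys h => ?_⟩
    rw [Language.BoundedFormula.realize_imp, Language.BoundedFormula.realize_imp,
      hM hf hg P hfin h0 hsub (hP.mono (by simp)) v w xs ys h,
      hN hf hg P hfin h0 hsub (hP.mono (by simp)) v w xs ys h]
  | all φ ih =>
    obtain ⟨N, hN⟩ := ih
    refine ⟨N + 1, fun {A B} _ _ {f g} hf hg P hfin h0 hsub hP v w xs ys h => ?_⟩
    have hlt : (N : Ordinal.{u}) < (N + 1 : ℕ) := by exact_mod_cast N.lt_succ_self
    have extend : ∀ x y, IsOmegaPowCorrespondence (N : Ordinal.{u}) (insert (f x, g y) P) →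
        (φ.Realize v (Fin.snoc xs x) ↔ φ.Realize w (Fin.snoc ys y)) := by
      intro x y hxy
      refine hN hf hg _ (hfin.insert _) (Or.inr h0)
        (Set.insert_subset ⟨⟨x, rfl⟩, ⟨y, rfl⟩⟩ hsub) hxy v w _ _ ?_
      rintro (i | i)
      · exact Or.inr (h (Sum.inl i))
      · refine Fin.lastCases ?_ (fun j => ?_) i
        · simp
        · simpa using Or.inr (h (Sum.inr j))
    rw [Language.BoundedFormula.realize_all, Language.BoundedFormula.realize_all]
    constructor
    · intro H y
      -- The back move is the forth move with the two sides exchanged.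
      obtain ⟨d, ⟨p, hp, hd⟩, hins⟩ := hP.preimage_swap.exists_insert hlt
        (hfin.preimage Prod.swap_injective.injOn) h0 (g y)
      obtain ⟨z, hz⟩ := (hsub hp).1
      obtain ⟨x, rfl⟩ := hf.mem_range_of_lt z (N + 1) d (by rw [hz]; exact hd)
      refine (extend x y ?_).1 (H x)
      convert hins.preimage_swap using 1
      ext ⟨a, b⟩
      simp [and_comm]
    · intro H x
      obtain ⟨d, ⟨p, hp, hd⟩, hins⟩ := hP.exists_insert hlt hfin h0 (f x)
      obtain ⟨z, hz⟩ := (hsub hp).2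
      obtain ⟨y, rfl⟩ := hg.mem_range_of_lt z (N + 1) d (by rw [hz]; exact hd)
      exact (extend x y hins).2 (H y)

theorem IsOmegaPowClosed.elementarilyEquivalent {A B : Type*} [LinearOrder A] [LinearOrder B]
    [Nonempty A] [Nonempty B] {f : A → Ordinal.{u}} {g : B → Ordinal.{u}}
    (hf : IsOmegaPowClosed f) (hg : IsOmegaPowClosed g) :
    strictOrderLanguage.ElementarilyEquivalent A B := by
  refine Language.elementarilyEquivalent_iff.2 fun φ => ?_
  obtain ⟨N, hN⟩ := exists_rank_realize_iff φ
  refine hN hf hg {(0, 0)} (Set.finite_singleton _) rfl ?_ ?_ _ _ _ _ ?_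
  · obtain ⟨x⟩ := ‹Nonempty A›
    obtain ⟨y⟩ := ‹Nonempty B›
    have pos : ∀ c : Ordinal.{u}, 0 < c + ω ^ ((0 : ℕ) : Ordinal.{u}) := fun c =>
      (opow_pos _ omega0_pos).trans_le le_add_self
    exact Set.singleton_subset_iff.2
      ⟨hf.mem_range_of_lt x 0 0 (pos _), hg.mem_range_of_lt y 0 0 (pos _)⟩
  · rintro _ rfl _ rfl
    exact OmegaPowEquiv.refl _ _
  · rintro (i | i)
    · exact i.elim
    · exact i.elim0

theorem isOmegaPowClosed_id : IsOmegaPowClosed (id : Ordinal.{u} → Ordinal.{u}) :=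
  ⟨strictMono_id, fun _ _ c _ => ⟨c, rfl⟩⟩

theorem isOmegaPowClosed_val_Iio_ord {κ : Cardinal.{u}} (hκ : Cardinal.aleph0 < κ) :
    IsOmegaPowClosed (Subtype.val : Set.Iio κ.ord → Ordinal.{u}) := by
  refine ⟨Subtype.strictMono_coe _, fun x n c hc => ⟨⟨c, hc.trans ?_⟩, rfl⟩⟩
  -- Uncountability enters here: it puts `ω`, and so every `ω ^ n`, below `κ.ord`.
  have hω : ω < κ.ord := by rwa [← Cardinal.ord_aleph0, Cardinal.ord_lt_ord]
  exact Ordinal.isPrincipal_add_ord hκ.le x.2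
    (Ordinal.isPrincipal_opow_ord hκ.le hω ((natCast_lt_omega0 n).trans hω))

/-- `On` is the class of all ordinals `Ordinal.{u}`. A cardinal `κ` is identified with its initial
ordinal `κ.ord`, and that ordinal with the set of all smaller ordinals, so that `⟨κ, <⟩` is
`Set.Iio κ.ord` with the order induced from `On`. -/
theorem theoremT (κ : Cardinal.{u}) (hκ : Cardinal.aleph0 < κ) :
    strictOrderLanguage.ElementarilyEquivalent (Set.Iio κ.ord) Ordinal.{u} := by
  have hpos : 0 < κ.ord := Cardinal.ord_zero ▸ Cardinal.ord_lt_ord.2 (Cardinal.aleph0_pos.trans hκ)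
  have : Nonempty (Set.Iio κ.ord) := ⟨⟨0, hpos⟩⟩
  exact (isOmegaPowClosed_val_Iio_ord hκ).elementarilyEquivalent isOmegaPowClosed_id
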